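/- Let $n\ge 0$ and let phase space be $\mathbb R^n\times\mathbb R^n\ni x=(q,p)$ with Lebesgue measure $dx$ and Poisson bracket $\{f,g\}=\sum_i(\partial_{q_i}f\,\partial_{p_i}g-\partial_{p_i}f\,\partial_{q_i}g)$. Let $H(x;\lambda)$ be a Hamiltonian, depending on a parameter $\lambda$ in a topological space, which is $C^2$ in $x$ with first and second $x$-derivatives jointly continuous in $(\lambda,x)$, and let $t\mapsto\lambda_t$, $t\ge 0$, be a continuous driving protocol. Assume that Hamilton's equations for $H(\cdot\,;\lambda_t)$ have solutions on all of $[0,\infty)$ through every phase space point at every time $s\ge0$ (forward and backward), and write $\phi_{t,s}$ for the resulting flow. Let the partition into sets $\chi_\alpha=\chi^{-1}(\{\alpha\})$ be given by a measurable map $\chi$ from phase space to a measurable space of mesostates $\alpha$ (discrete or continuous). The mesostate $\rho(\alpha)=\int_{\chi_\alpha}\rho(x)\,dx$ of an integrable function $\rho$ on phase space is understood as the signed measure $B\mapsto\int_{\chi^{-1}(B)}\rho(x)\,dx$. Let $I\subseteq[0,\infty)$ be a time interval, and assume that the dynamics is lumpable on $I$ with generator $\mathcal V(\lambda_t,t)$,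 in the following sense: (i) for every initial probability density $\rho(x;0)$, the lumped process $t\mapsto\chi(\phi_{t,0}(x))$ with $x$ distributed according to $\rho(x;0)$ is Markovian for times in $I$; (ii) $\mathcal V(\lambda_t,t)$, $t\in I$, are (not necessarily everywhere defined) linear operators on signed measures on the space of mesostates which do not depend on the initial distribution and generate the exact reduced dynamics: for every jointly differentiable family of probability densities $\rho(x;t)$, $t\ge 0$, solving the Liouville equation $\partial_t\rho(x;t)=\{H(x;\lambda_t),\rho(x;t)\}$, and every $t\in I$ at which the mesostate $\rho(\alpha;t)$ has a time derivative (the probability of each measurable set of mesostates being differentiable at $t$, with derivatives given by a signed measure), $\rho(\alpha;t)$ lies in the domain of $\mathcal V(\lambda_t,t)$ and $\frac{d}{dt}\rho(\alpha;t)=\mathcal V(\lambda_t,t)\rho(\alpha;t)$. Let $\beta>0$, and assume that for all $t\in I$ the partition function $Z(\lambda_t)=\int e^{-\beta H(x;\lambda_t)}dx$ is finite and, with the Gibbs state $\pi(x;\lambda_t)=e^{-\beta H(x;\lambda_t)}/Z(\lambda_t)$, that the map $r\mapsto\{H(\cdot\,;\lambda_r),\pi(\cdot\,;\lambda_t)\}$,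 $r\ge 0$, is continuous at $r=t$ with respect to the $L^1(dx)$ distance. (This is automatic if $\lambda$ is constant.) Then for all $t\in I$ the marginal of the global Gibbs state, $$\pi(\alpha;\lambda_t)=\int_{\chi_\alpha}\frac{e^{-\beta H(x;\lambda_t)}}{Z(\lambda_t)}\,dx,$$ is an instantaneous fixed point of the reduced dynamics: it lies in the domain of $\mathcal V(\lambda_t,t)$, and $\mathcal V(\lambda_t,t)\,\pi(\alpha;\lambda_t)=0$. -/

import Mathlib

open MeasureTheory Set Filter Topology

noncomputable section

/-- Phase space of a system with `n` degrees of freedom: points `x = (q, p)`, positions `q` and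
momenta `p` in `ℝⁿ`. Its `volume` is the Lebesgue (Liouville) measure `dq dp`. -/
abbrev PhaseSpace (n : ℕ) : Type := (Fin n → ℝ) × (Fin n → ℝ)

namespace PhaseSpace

/-- `∂f/∂qᵢ`. -/
def partialQ {n : ℕ} (f : PhaseSpace n → ℝ) (i : Fin n) (x : PhaseSpace n) : ℝ :=
  fderiv ℝ f x (Pi.single i 1, 0)

/-- `∂f/∂pᵢ`. -/
def partialP {n : ℕ} (f : PhaseSpace n → ℝ) (i : Fin n) (x : PhaseSpace n) : ℝ :=
  fderiv ℝ f x (0, Pi.single i 1)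

/-- The Poisson bracket `{f, g} = ∑ᵢ (∂f/∂qᵢ ∂g/∂pᵢ - ∂f/∂pᵢ ∂g/∂qᵢ)`. -/
def poisson {n : ℕ} (f g : PhaseSpace n → ℝ) (x : PhaseSpace n) : ℝ :=
  ∑ i, (partialQ f i x * partialP g i x - partialP f i x * partialQ g i x)

/-- The right hand side of Hamilton's equations, `(q̇, ṗ) = (∂H/∂p, -∂H/∂q)`. -/
def hamiltonVF {n : ℕ} (h : PhaseSpace n → ℝ) (x : PhaseSpace n) : PhaseSpace n :=
  (fun i => partialP h i x, fun i => - partialQ h i x)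

end PhaseSpace

open PhaseSpace

/-- A parametrised Hamiltonian `H(x; l)` that is twice differentiable in `x`, with
`x`-derivatives of first and second order that are jointly continuous in `(l, x)`. -/
structure IsRegularHamiltonian {n : ℕ} {L : Type*} [TopologicalSpace L]
    (H : L → PhaseSpace n → ℝ) : Prop where
  contDiff : ∀ l, ContDiff ℝ 2 (H l)
  continuous_fderiv : Continuous fun z : L × PhaseSpace n => fderiv ℝ (H z.1) z.2
  continuous_fderiv_fderiv :
    Continuous fun z : L × PhaseSpace n => fderiv ℝ (fderiv ℝ (H z.1)) z.2

/-- `φ t s x` is the phase space point at time `t` of the trajectory that passes through `x` at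
time `s`; the trajectories solve Hamilton's equations with the Hamiltonian `H(·; lam t)` for all
times in `[0, ∞)`, also backward in time from `s` to `0`. -/
structure IsHamiltonianFlow {n : ℕ} {L : Type*} (H : L → PhaseSpace n → ℝ) (lam : ℝ → L)
    (φ : ℝ → ℝ → PhaseSpace n → PhaseSpace n) : Prop where
  self : ∀ s, 0 ≤ s → ∀ x, φ s s x = x
  hamilton : ∀ s, 0 ≤ s → ∀ x, ∀ t, 0 ≤ t →
    HasDerivWithinAt (fun r => φ r s x) (hamiltonVF (H (lam t)) (φ t s x)) (Ici 0) t

/-- A probability density on phase space. -/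
structure IsProbDensity {n : ℕ} (ρ : PhaseSpace n → ℝ) : Prop where
  nonneg : ∀ x, 0 ≤ ρ x
  integrable : Integrable ρ volume
  integral_eq_one : ∫ x, ρ x = 1

/-- `ρ t x` is a classical solution, for times `t ≥ 0`, of the Liouville equation
`∂ρ/∂t = {H(·; lam t), ρ}`, and `ρ t` is a probability density for each `t ≥ 0`. -/
structure IsLiouvilleSolution {n : ℕ} {L : Type*} (H : L → PhaseSpace n → ℝ) (lam : ℝ → L)
    (ρ : ℝ → PhaseSpace n → ℝ) : Prop where
  differentiable : DifferentiableOn ℝ (fun z : ℝ × PhaseSpace n => ρ z.1 z.2) (Ici 0 ×ˢ univ)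
  isProbDensity : ∀ t, 0 ≤ t → IsProbDensity (ρ t)
  liouville : ∀ t, 0 ≤ t → ∀ x,
    HasDerivWithinAt (fun s => ρ s x) (poisson (H (lam t)) (ρ t) x) (Ici 0) t

/-- The mesostate of the phase space density `ρ`. The partition is given by the map `χ`, which
sends a microstate to its mesostate label, so that `χ_α = χ ⁻¹' {α}`; labels may be discrete or
continuous. The mesostate is the law of the label: it assigns to a set `B` of labels the number
`∫_{χ ⁻¹' B} ρ(x) dx`. For discrete labels, `B = {α}` gives `ρ(α) = ∫_{χ_α} ρ(x) dx`; for
continuous labels this is the measure with density `ρ(α)`. -/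
def mesoState {n : ℕ} {A : Type*} [MeasurableSpace A] (χ : PhaseSpace n → A)
    (ρ : PhaseSpace n → ℝ) : SignedMeasure A :=
  (volume.withDensityᵥ ρ).map χ

theorem mesoState_apply {n : ℕ} {A : Type*} [MeasurableSpace A] {χ : PhaseSpace n → A}
    (hχ : Measurable χ) {ρ : PhaseSpace n → ℝ} (hρ : Integrable ρ volume) {B : Set A}
    (hB : MeasurableSet B) : mesoState χ ρ B = ∫ x in χ ⁻¹' B, ρ x := by
  rw [mesoState, VectorMeasure.map_apply _ hχ hB, withDensityᵥ_apply hρ (hχ hB)]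

/-- The probability measure on phase space with density `ρ₀`. -/
def initialLaw {n : ℕ} (ρ₀ : PhaseSpace n → ℝ) : Measure (PhaseSpace n) :=
  volume.withDensity fun x => ENNReal.ofReal (ρ₀ x)

/-- The lumped process `t ↦ Y t` with initial microstate distributed according to `P` is
Markovian for times in `I`: given the mesostates at the times `r ≤ s` in `I`, the conditional
probability of `Y t ∈ B` depends on the mesostate at time `s` only. -/
def IsMarkovOn {Ω A : Type*} [MeasurableSpace Ω] [MeasurableSpace A] (P : Measure Ω)
    (Y : ℝ → Ω → A) (I : Set ℝ) : Prop :=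
  ∀ s ∈ I, ∀ t ∈ I, s ≤ t → ∀ B : Set A, MeasurableSet B →
    P[(Y t ⁻¹' B).indicator (fun _ => (1 : ℝ)) |
        ⨆ r ∈ I ∩ Iic s, MeasurableSpace.comap (Y r) inferInstance]
      =ᵐ[P] P[(Y t ⁻¹' B).indicator (fun _ => (1 : ℝ)) |
        MeasurableSpace.comap (Y s) inferInstance]

/-- The curve `μ` of mesostates has the time derivative `ν` at time `t`: the probability of each
set of mesostates is differentiable (one-sidedly at the initial time `0`). -/
def HasMesoDerivAt {A : Type*} [MeasurableSpace A] (μ : ℝ → SignedMeasure A)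
    (ν : SignedMeasure A) (t : ℝ) : Prop :=
  ∀ B : Set A, MeasurableSet B → HasDerivWithinAt (fun s => μ s B) (ν B) (Ici 0) t

/-- The Hamiltonian dynamics is lumpable on `I` with respect to the partition `χ`, and `V t` is
the generator of the reduced dynamics. For every initial distribution the lumped process is
Markovian on `I`, and one and the same family `V` of (possibly unbounded, hence only partially
defined) linear operators generates the mesostates from every initial distribution: at each
`t ∈ I` at which the mesostate has a time derivative, `d/dt ρ(α; t) = V t ρ(α; t)`. -/
structure IsLumpableOn {n : ℕ} {L A : Type*} [MeasurableSpace A] (H : L → PhaseSpace n → ℝ)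
    (lam : ℝ → L) (φ : ℝ → ℝ → PhaseSpace n → PhaseSpace n) (χ : PhaseSpace n → A)
    (I : Set ℝ) (V : ℝ → (SignedMeasure A →ₗ.[ℝ] SignedMeasure A)) : Prop where
  markov : ∀ ρ₀ : PhaseSpace n → ℝ, IsProbDensity ρ₀ →
    IsMarkovOn (initialLaw ρ₀) (fun t x => χ (φ t 0 x)) I
  generator : ∀ ρ : ℝ → PhaseSpace n → ℝ, IsLiouvilleSolution H lam ρ → ∀ t ∈ I,
    ∀ ν : SignedMeasure A, HasMesoDerivAt (fun s => mesoState χ (ρ s)) ν t →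
      ∃ hdom : mesoState χ (ρ t) ∈ (V t).domain, V t ⟨mesoState χ (ρ t), hdom⟩ = ν

/-- `μ` is an instantaneous fixed point of the generator `W`: it lies in the domain of `W`, and
`W μ = 0`. -/
def IsInstantaneousFixedPoint {A : Type*} [MeasurableSpace A]
    (W : SignedMeasure A →ₗ.[ℝ] SignedMeasure A) (μ : SignedMeasure A) : Prop :=
  ∃ hdom : μ ∈ W.domain, W ⟨μ, hdom⟩ = 0

/-- The partition function `Z = ∫ exp(-β h(x)) dx`. -/
def partitionFunction {n : ℕ} (β : ℝ) (h : PhaseSpace n → ℝ) : ℝ :=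
  ∫ x, Real.exp (-β * h x)

/-- The Gibbs state `exp(-β h(x)) / Z`. -/
def gibbs {n : ℕ} (β : ℝ) (h : PhaseSpace n → ℝ) (x : PhaseSpace n) : ℝ :=
  Real.exp (-β * h x) / partitionFunction β h

end

/-! Fix `t` in `I`, write `π` for the Gibbs state at time `t`, and feed the generator the Liouville
solution `ρ(x;s) = π(φ t s x)`, which equals `π` at `s = t`. Uniqueness of the time derivative is
not needed: it suffices that the mesostate of this solution has derivative `0` at `t`, and
`IsLumpableOn.generator` then yields the domain membership and the value `0`.

The derivative vanishes because the flow preserves volume: integrating along trajectories bounds the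
`L¹` distance of `π ∘ φ t s` from `π` by the time integral, between `s` and `t`, of the `L¹` norm of
`{H(·; lam r), π}` (`IsFlow.lintegral_enorm_sub_le`). At `r = t` the bracket is zero since `π` is a
function of `H`, so by the `L¹` continuity hypothesis the bound is `o(|s - t|)`, uniformly over sets
of mesostates (`IsHamiltonianFlow.hasMesoDerivAt_zero`).

That `π ∘ φ t s` is a classical solution with unit mass (`IsHamiltonianFlow.isLiouvilleSolution`)
requires joint differentiability of the flow in initial time and position, and Liouville's theorem.
Both come from the variational equation, whose solution preserves the symplectic form and so has
determinant of absolute value one. -/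

noncomputable section

open PhaseSpace

/-! ### Trajectories: comparison, uniqueness, linear equations. -/

section Flow

variable {E : Type*} [NormedAddCommGroup E] [NormedSpace ℝ E]

/-- Fencing in both time directions: a curve starting at time `a` inside the barrier
`B |r - a|` cannot cross it on the way to time `b`. -/
theorem norm_le_barrier_of_norm_deriv_lt {f f' : ℝ → E} {a b : ℝ}
    (hf : ∀ r ∈ uIcc a b, HasDerivWithinAt f (f' r) (uIcc a b) r)
    {B B' : ℝ → ℝ} (hB : ∀ u, HasDerivAt B (B' u) u) (ha : ‖f a‖ ≤ B 0)
    (bound : ∀ r ∈ uIcc a b, ‖f r‖ = B |r - a| → ‖f' r‖ < B' |r - a|) :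
    ‖f b‖ ≤ B |b - a| := by
  have key : ∀ {g g' : ℝ → E} {c : ℝ}, 0 ≤ c →
      (∀ r ∈ Icc 0 c, HasDerivWithinAt g (g' r) (Icc 0 c) r) → ‖g 0‖ ≤ B 0 →
      (∀ r ∈ Icc 0 c, ‖g r‖ = B r → ‖g' r‖ < B' r) → ‖g c‖ ≤ B c := by
    intro g g' c hc hg h0 hb
    refine image_norm_le_of_norm_deriv_right_lt_deriv_boundary (a := 0) (b := c)
      (fun r hr => (hg r hr).continuousWithinAt)
      (fun r hr => (hg r (Ico_subset_Icc_self hr)).mono_of_mem_nhdsWithin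
        (Icc_mem_nhdsGE_of_mem hr)) h0 hB
      (fun r hr => hb r (Ico_subset_Icc_self hr)) (right_mem_Icc.2 hc)
  rcases le_total a b with hab | hab
  · rw [uIcc_of_le hab] at hf bound
    have hm : MapsTo (fun u => a + u) (Icc 0 (b - a)) (Icc a b) := fun u hu =>
      ⟨by linarith [hu.1], by linarith [hu.2]⟩
    have := key (g := fun u => f (a + u)) (g' := fun u => f' (a + u)) (sub_nonneg.2 hab)
      (fun u hu => by
        have h := (hf _ (hm hu)).scomp u (((hasDerivAt_id u).const_add a).hasDerivWithinAt) hm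
        simpa [Function.comp_def] using h)
      (by simpa using ha)
      (fun u hu h => by
        have := bound _ (hm hu)
        rw [add_sub_cancel_left, abs_of_nonneg hu.1] at this
        exact this h)
    simpa [abs_of_nonneg (sub_nonneg.2 hab)] using this
  · rw [uIcc_of_ge hab] at hf bound
    have hm : MapsTo (fun u => a - u) (Icc 0 (a - b)) (Icc b a) := fun u hu =>
      ⟨by linarith [hu.2], by linarith [hu.1]⟩
    have := key (g := fun u => f (a - u)) (g' := fun u => -f' (a - u)) (sub_nonneg.2 hab)
      (fun u hu => by
        have h := (hf _ (hm hu)).scomp u (((hasDerivAt_id u).const_sub a).hasDerivWithinAt) hm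
        simpa [Function.comp_def] using h)
      (by simpa using ha)
      (fun u hu h => by
        have := bound _ (hm hu)
        rw [sub_sub_cancel_left, abs_neg, abs_of_nonneg hu.1] at this
        rw [norm_neg]
        exact this h)
    rw [abs_sub_comm]
    simpa [abs_of_nonneg (sub_nonneg.2 hab)] using this

/-- A time dependent vector field with a spatial derivative, both jointly continuous. -/
structure IsC1VectorField (X : ℝ → E → E) (DX : ℝ → E → E →L[ℝ] E) : Prop where
  continuous : Continuous fun z : ℝ × E => X z.1 z.2
  continuous_deriv : Continuous fun z : ℝ × E => DX z.1 z.2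
  hasFDerivAt : ∀ t x, HasFDerivAt (X t) (DX t x) x

/-- The curve `g` follows the vector field `X` on `[0, ∞)`. -/
def IsTrajectory (X : ℝ → E → E) (g : ℝ → E) : Prop :=
  ∀ t, 0 ≤ t → HasDerivWithinAt g (X t (g t)) (Ici 0) t

/-- `φ t s x` is the position at time `t` of the trajectory through `x` at time `s`. -/
structure IsFlow (X : ℝ → E → E) (φ : ℝ → ℝ → E → E) : Prop where
  self : ∀ s, 0 ≤ s → ∀ x, φ s s x = x
  trajectory : ∀ s, 0 ≤ s → ∀ x, IsTrajectory X fun r => φ r s x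

variable {X : ℝ → E → E} {DX : ℝ → E → E →L[ℝ] E} {g h : ℝ → E} {N : ℝ}

theorem IsTrajectory.continuousOn (hg : IsTrajectory X g) : ContinuousOn g (Ici 0) :=
  fun t ht => (hg t ht).continuousWithinAt

theorem IsTrajectory.continuous_max (hg : IsTrajectory X g) : Continuous fun t => g (max t 0) :=
  hg.continuousOn.comp_continuous (by fun_prop) fun t => le_max_right t 0

theorem uIcc_subset_Ici {a b : ℝ} (ha : 0 ≤ a) (hb : 0 ≤ b) : uIcc a b ⊆ Ici 0 :=
  fun _ hr => (le_min ha hb).trans hr.1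

theorem IsTrajectory.hasDerivWithinAt_uIcc (hg : IsTrajectory X g) {a b r : ℝ} (ha : 0 ≤ a)
    (hb : 0 ≤ b) (hr : r ∈ uIcc a b) : HasDerivWithinAt g (X r (g r)) (uIcc a b) r :=
  (hg r (uIcc_subset_Ici ha hb hr)).mono (uIcc_subset_Ici ha hb)

theorem IsC1VectorField.continuous_deriv_along (hX : IsC1VectorField X DX)
    (hg : IsTrajectory X g) : Continuous fun t => DX t (g (max t 0)) :=
  hX.continuous_deriv.comp (continuous_id.prodMk hg.continuous_max)

theorem IsC1VectorField.exists_bound_deriv (hX : IsC1VectorField X DX) (hg : IsTrajectory X g)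
    (a b : ℝ) : ∃ M, 0 < M ∧ ∀ t ∈ Icc a b, ‖DX t (g (max t 0))‖ ≤ M := by
  obtain ⟨M, hM⟩ := (isCompact_Icc (a := a) (b := b)).exists_bound_of_continuousOn
    (hX.continuous_deriv_along hg).continuousOn
  exact ⟨max M 1, by positivity, fun t ht => (hM t ht).trans (le_max_left _ _)⟩

/-- Linearisation along a trajectory, uniformly on compact time intervals. -/
theorem IsC1VectorField.linearization (hX : IsC1VectorField X DX) (hg : IsTrajectory X g)
    (N : ℝ) {ε : ℝ} (hε : 0 < ε) : ∃ δ > 0, ∀ t ∈ Icc 0 N, ∀ z, ‖z - g t‖ ≤ δ →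
      ‖X t z - X t (g t) - DX t (g t) (z - g t)‖ ≤ ε * ‖z - g t‖ := by
  have hc : Continuous fun q : E × ℝ =>
      DX q.2 (g (max q.2 0) + q.1) - DX q.2 (g (max q.2 0)) := by
    have h1 : Continuous fun q : E × ℝ => g (max q.2 0) := hg.continuous_max.comp continuous_snd
    exact (hX.continuous_deriv.comp (continuous_snd.prodMk (h1.add continuous_fst))).sub
      (hX.continuous_deriv.comp (continuous_snd.prodMk h1))
  -- Tube lemma: continuity at displacement `0` for each time becomes uniform over the compact time
  -- interval.
  have hev := (isCompact_Icc (a := (0 : ℝ)) (b := N)).eventually_forall_of_forall_eventually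
    (x₀ := (0 : E))
    (P := fun v t => ‖DX t (g (max t 0) + v) - DX t (g (max t 0))‖ < ε)
    (fun t _ => (hc.norm.tendsto (0, t)).eventually_lt_const (by simpa using hε))
  obtain ⟨δ, hδ, hball⟩ := Metric.eventually_nhds_iff_ball.1 hev
  refine ⟨δ / 2, half_pos hδ, fun t ht z hz => ?_⟩
  refine (convex_closedBall (g t) (δ / 2)).norm_image_sub_le_of_norm_hasFDerivWithin_le'
    (f' := fun x => DX t x) (fun x _ => (hX.hasFDerivAt t x).hasFDerivWithinAt) (fun x hx => ?_)
    (Metric.mem_closedBall_self (half_pos hδ).le) (by simpa [dist_eq_norm] using hz)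
  have := hball (x - g t) (by
    rw [Metric.mem_closedBall, dist_eq_norm] at hx
    rw [mem_ball_zero_iff]; linarith) t ht
  rw [max_eq_left ht.1, add_sub_cancel] at this
  exact this.le

/-- Lipschitz dependence of trajectories on their position at any time of a compact interval. -/
theorem IsC1VectorField.exists_lipschitz (hX : IsC1VectorField X DX) (hg : IsTrajectory X g)
    (N : ℝ) : ∃ C > 0, ∃ δ > 0, ∀ s ∈ Icc 0 N, ∀ h, IsTrajectory X h → ∀ η, 0 < η → η ≤ δ →
      ‖h s - g s‖ ≤ η → ∀ t ∈ Icc 0 N, ‖h t - g t‖ ≤ C * η := by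
  obtain ⟨δ, hδ, hlin⟩ := hX.linearization hg N one_pos
  obtain ⟨M, hM, hbd⟩ := hX.exists_bound_deriv hg 0 N
  -- Growth rate `M + 2`: `M` bounds the linear part, `1` the linearisation error, and the last `1`
  -- makes the barrier inequality strict. Dividing `δ` by the exponential keeps the barrier inside
  -- the region where the linearisation holds.
  refine ⟨Real.exp ((M + 2) * N), Real.exp_pos _, δ / Real.exp ((M + 2) * N), by positivity, ?_⟩
  intro s hs h hh η hη hηδ hhs t ht
  rw [le_div_iff₀ (Real.exp_pos _)] at hηδ
  have hsub : uIcc s t ⊆ Icc 0 N := uIcc_subset_Icc hs ht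
  have hexp : ∀ r ∈ uIcc s t, η * Real.exp ((M + 2) * |r - s|) ≤ η * Real.exp ((M + 2) * N) := by
    intro r hr
    have : |r - s| ≤ N := abs_le.2 ⟨by linarith [(hsub hr).1, hs.2], by linarith [(hsub hr).2, hs.1]⟩
    gcongr
  have hB : ∀ u, HasDerivAt (fun u => η * Real.exp ((M + 2) * u))
      (η * (Real.exp ((M + 2) * u) * (M + 2))) u := fun u => by
    simpa using (((hasDerivAt_id u).const_mul (M + 2)).exp).const_mul η
  have := norm_le_barrier_of_norm_deriv_lt (f := fun r => h r - g r)
    (f' := fun r => X r (h r) - X r (g r)) (a := s) (b := t)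
    (fun r hr => (hh.hasDerivWithinAt_uIcc hs.1 ht.1 hr).sub
      (hg.hasDerivWithinAt_uIcc hs.1 ht.1 hr)) hB (by simpa using hhs)
    (fun r hr heq => by
      have hle := hexp r hr
      rw [← heq] at hle
      have h1 := hlin r (hsub hr) (h r) (by linarith)
      have h2 := hbd r (hsub hr)
      rw [max_eq_left (hsub hr).1] at h2
      have h3 := (DX r (g r)).le_of_opNorm_le h2 (h r - g r)
      have h4 : ‖X r (h r) - X r (g r)‖ ≤
          ‖X r (h r) - X r (g r) - DX r (g r) (h r - g r)‖ + ‖DX r (g r) (h r - g r)‖ := by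
        simpa using norm_add_le (X r (h r) - X r (g r) - DX r (g r) (h r - g r))
          (DX r (g r) (h r - g r))
      have hpos : 0 < ‖h r - g r‖ := by rw [heq]; positivity
      have h5 : η * (Real.exp ((M + 2) * |r - s|) * (M + 2)) = (M + 2) * ‖h r - g r‖ := by
        rw [heq]; ring
      rw [h5]
      nlinarith)
  calc ‖h t - g t‖ ≤ _ := this
    _ ≤ _ := hexp t right_mem_uIcc
    _ = _ := mul_comm _ _

/-- The Lipschitz estimate needs a positive initial error `η`; equal initial points allow every
small `η`, and `η → 0` closes the gap. -/
theorem IsC1VectorField.trajectory_unique (hX : IsC1VectorField X DX) (hg : IsTrajectory X g)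
    (hh : IsTrajectory X h) {s t : ℝ} (hs : 0 ≤ s) (ht : 0 ≤ t) (heq : h s = g s) :
    h t = g t := by
  obtain ⟨C, hC, δ, hδ, H⟩ := hX.exists_lipschitz hg (max s t)
  have hle : ∀ᶠ η in 𝓝[>] (0 : ℝ), ‖h t - g t‖ ≤ C * η := by
    filter_upwards [Ioc_mem_nhdsGT hδ] with η hη
    exact H s ⟨hs, le_max_left _ _⟩ h hh η hη.1 hη.2 (by simpa [heq] using hη.1.le) t
      ⟨ht, le_max_right _ _⟩
  have hlim : Tendsto (fun η => C * η) (𝓝[>] (0 : ℝ)) (𝓝 0) := by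
    have : Tendsto (fun η => C * η) (𝓝 (0 : ℝ)) (𝓝 (C * 0)) := tendsto_id.const_mul C
    rw [mul_zero] at this
    exact this.mono_left nhdsWithin_le_nhds
  exact sub_eq_zero.1 (norm_le_zero_iff.1 (ge_of_tendsto hlim hle))

variable {φ : ℝ → ℝ → E → E}

theorem IsFlow.comp_apply (hφ : IsFlow X φ) (hX : IsC1VectorField X DX) {s t u : ℝ} (hs : 0 ≤ s)
    (ht : 0 ≤ t) (hu : 0 ≤ u) (x : E) : φ u t (φ t s x) = φ u s x :=
  hX.trajectory_unique (hφ.trajectory s hs x) (hφ.trajectory t ht _) ht hu (hφ.self t ht _)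

theorem IsFlow.inverse_apply (hφ : IsFlow X φ) (hX : IsC1VectorField X DX) {s t : ℝ} (hs : 0 ≤ s)
    (ht : 0 ≤ t) (x : E) : φ s t (φ t s x) = x := by
  rw [hφ.comp_apply hX hs ht hs, hφ.self s hs]

/-- Picard–Lindelöf on the unit ball about `y`: there `‖x‖ ≤ 2`, so the field is at most `2 * M`,
and `2 * M * δ ≤ 1` keeps the solution in the ball. -/
theorem exists_linear_ode_solution {F : Type*} [NormedAddCommGroup F] [NormedSpace ℝ F]
    [CompleteSpace F] {A : ℝ → F →L[ℝ] F} {s δ M : ℝ} (hδ : 0 < δ) (hM : 0 < M)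
    (hA : ContinuousOn A (Icc (s - δ) (s + δ))) (hbd : ∀ t ∈ Icc (s - δ) (s + δ), ‖A t‖ ≤ M)
    (hMδ : 2 * M * δ ≤ 1) {y : F} (hy : ‖y‖ ≤ 1) :
    ∃ J : ℝ → F, J s = y ∧
      ∀ t ∈ Icc (s - δ) (s + δ), HasDerivWithinAt J (A t (J t)) (Icc (s - δ) (s + δ)) t := by
  have hpl : IsPicardLindelof (fun t x => A t x)
      (⟨s, by constructor <;> linarith⟩ : Icc (s - δ) (s + δ)) y 1 0 (2 * ⟨M, hM.le⟩) ⟨M, hM.le⟩ :=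
    { lipschitzOnWith := fun t ht =>
        ((A t).lipschitz.weaken (by exact_mod_cast hbd t ht)).lipschitzOnWith
      continuousOn := fun x _ => hA.clm_apply continuousOn_const
      norm_le := fun t ht x hx => by
        have h1 : ‖x‖ ≤ 2 := by
          rw [Metric.mem_closedBall, dist_eq_norm] at hx
          have := norm_add_le (x - y) y
          rw [sub_add_cancel] at this
          have h2 : ((1 : NNReal) : ℝ) = 1 := rfl
          linarith
        have := (A t).le_of_opNorm_le_of_le (hbd t ht) h1
        change _ ≤ 2 * M
        linarith
      mul_max_le := by
        push_cast
        change 2 * M * max (s + δ - s) (s - (s - δ)) ≤ 1 - 0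
        simpa using hMδ }
  exact hpl.exists_eq_forall_mem_Icc_hasDerivWithinAt₀

end Flow

/-! ### Differentiability of the flow in position and initial time. -/

section FlowDeriv

variable {E : Type*} [NormedAddCommGroup E] [NormedSpace ℝ E] {X : ℝ → E → E}
  {DX : ℝ → E → E →L[ℝ] E} {g : ℝ → E} {φ : ℝ → ℝ → E → E} {ω : E →L[ℝ] E →L[ℝ] ℝ}

theorem IsTrajectory.hasDerivWithinAt_comp {g : ℝ → E} (hg : IsTrajectory X g) {F : E → ℝ}
    (hF : ContDiff ℝ 1 F) {t : ℝ} (ht : 0 ≤ t) :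
    HasDerivWithinAt (fun r => F (g r)) (fderiv ℝ F (g t) (X t (g t))) (Ici 0) t :=
  ((hF.differentiable one_ne_zero).differentiableAt.hasFDerivAt).comp_hasDerivWithinAt t (hg t ht)

/-- For times close to each other, the flow maps are differentiable along a given trajectory, and
their derivatives preserve a bilinear form that the linearised vector field preserves. -/
theorem IsFlow.exists_hasFDerivAt_of_abs_sub_le [CompleteSpace E] (hφ : IsFlow X φ)
    (hX : IsC1VectorField X DX)
    (hω : ∀ t x u v, ω (DX t x u) v + ω u (DX t x v) = 0) (hg : IsTrajectory X g) (N : ℝ) :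
    ∃ δ > 0, ∀ s ∈ Icc 0 N, ∀ t ∈ Icc 0 N, |t - s| ≤ δ → ∃ D : E →L[ℝ] E,
      HasFDerivAt (φ t s) D (g s) ∧ ∀ u v, ω (D u) (D v) = ω u v := by
  -- The interval is enlarged by `1` because the variational equation is solved on `[s - δ, s + δ]`
  -- with `δ ≤ 1`, which may leave `[0, N]`.
  obtain ⟨M, hM, hbd⟩ := hX.exists_bound_deriv hg (-1) (N + 1)
  set A : ℝ → E →L[ℝ] E := fun t => DX t (g (max t 0)) with hAdef
  have hAc : Continuous A := hX.continuous_deriv_along hg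
  obtain ⟨C, hC, δ₁, hδ₁, hlip⟩ := hX.exists_lipschitz hg N
  set δ := min 1 (1 / (2 * M)) with hδdef
  have hδ : 0 < δ := by positivity
  have hδ1 : δ ≤ 1 := min_le_left _ _
  have hMδ : 2 * M * δ ≤ 1 := by
    have : δ ≤ 1 / (2 * M) := min_le_right _ _
    rw [le_div_iff₀ (by positivity)] at this
    linarith
  refine ⟨δ, hδ, fun s hs t ht hst => ?_⟩
  have hIsub : Icc (s - δ) (s + δ) ⊆ Icc (-1) (N + 1) :=
    Icc_subset_Icc (by linarith [hs.1]) (by linarith [hs.2])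
  -- Variational equation `J' = A J` in the space of operators, with `J s = id`; `J t` is the
  -- candidate derivative.
  obtain ⟨J, hJs, hJ⟩ := exists_linear_ode_solution (F := E →L[ℝ] E)
    (A := fun t => ContinuousLinearMap.compL ℝ E E E (A t)) hδ hM
    ((ContinuousLinearMap.continuous _).comp hAc).continuousOn
    (fun r hr => (ContinuousLinearMap.opNorm_le_bound _ (norm_nonneg (A r)) fun B =>
      (A r).opNorm_comp_le B).trans (hbd r (hIsub hr))) hMδ ContinuousLinearMap.norm_id_le
  have hst' : uIcc s t ⊆ Icc (s - δ) (s + δ) := uIcc_subset_Icc (by constructor <;> linarith)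
    (by rw [abs_le] at hst; constructor <;> linarith)
  have hsub : uIcc s t ⊆ Icc 0 N := uIcc_subset_Icc hs ht
  have hJu : ∀ (u : E), ∀ r ∈ uIcc s t,
      HasDerivWithinAt (fun r => J r u) (A r (J r u)) (uIcc s t) r := fun u r hr => by
    have := ((hJ r (hst' hr)).mono hst').clm_apply (hasDerivWithinAt_const r (uIcc s t) u)
    simpa using this
  refine ⟨J t, ?_, fun u v => ?_⟩
  · rw [hasFDerivAt_iff_isLittleO_nhds_zero, Asymptotics.isLittleO_iff]
    intro c hc
    set K := Real.exp ((M + 1) * |t - s|) with hKdef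
    have hK : 0 < K := Real.exp_pos _
    -- Chosen so that the final barrier `2 * ε * C * ‖v‖ * K` equals `c * ‖v‖`. The factor `2` gives
    -- strictness: at contact the remainder is at least `2 * ε * C * ‖v‖`, while the linearisation
    -- error is at most half of that.
    set ε := c / (2 * C * K) with hεdef
    have hε : 0 < ε := by positivity
    obtain ⟨δ₂, hδ₂, hlin⟩ := hX.linearization hg N hε
    have hev : ∀ᶠ v in 𝓝 (0 : E), ‖v‖ < min δ₁ (δ₂ / C) := by
      have : Tendsto (fun v : E => ‖v‖) (𝓝 0) (𝓝 0) := tendsto_norm_zero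
      exact this.eventually_lt_const (by positivity)
    filter_upwards [hev] with v hv
    rcases eq_or_ne v 0 with rfl | hv0
    · simp
    have hvpos : 0 < ‖v‖ := norm_pos_iff.2 hv0
    have hv1 : ‖v‖ ≤ δ₁ := hv.le.trans (min_le_left _ _)
    have hv2 : C * ‖v‖ ≤ δ₂ := by
      have := hv.le.trans (min_le_right _ _)
      rw [le_div_iff₀ hC] at this
      linarith
    have htr := hφ.trajectory s hs.1 (g s + v)
    have hd := hlip s hs _ htr ‖v‖ hvpos hv1 (by simp [hφ.self s hs.1])
    have hgt : φ t s (g s) = g t :=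
      hX.trajectory_unique hg (hφ.trajectory s hs.1 (g s)) hs.1 ht.1 (hφ.self s hs.1 _)
    have hB : ∀ u, HasDerivAt (fun u => 2 * ε * C * ‖v‖ * Real.exp ((M + 1) * u))
        (2 * ε * C * ‖v‖ * (Real.exp ((M + 1) * u) * (M + 1))) u := fun u => by
      simpa using (((hasDerivAt_id u).const_mul (M + 1)).exp).const_mul (2 * ε * C * ‖v‖)
    have := norm_le_barrier_of_norm_deriv_lt (f := fun r => φ r s (g s + v) - g r - J r v)
      (f' := fun r => X r (φ r s (g s + v)) - X r (g r) - A r (J r v)) (a := s) (b := t)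
      (fun r hr => ((htr.hasDerivWithinAt_uIcc hs.1 ht.1 hr).sub
        (hg.hasDerivWithinAt_uIcc hs.1 ht.1 hr)).sub (hJu v r hr)) hB
      (by simp only [hφ.self s hs.1, hJs]; simp; positivity)
      (fun r hr heq => by
        have hr' := hsub hr
        have hdr := hd r hr'
        have h1 := hlin r hr' (φ r s (g s + v)) (hdr.trans hv2)
        have hAr : A r = DX r (g r) := by rw [hAdef]; simp only [max_eq_left hr'.1]
        have h3 := (A r).le_of_opNorm_le (hbd r (hIsub (hst' hr))) (φ r s (g s + v) - g r - J r v)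
        rw [← hAr] at h1
        have h4 : ‖X r (φ r s (g s + v)) - X r (g r) - A r (J r v)‖ ≤
            ‖X r (φ r s (g s + v)) - X r (g r) - A r (φ r s (g s + v) - g r)‖ +
              ‖A r (φ r s (g s + v) - g r - J r v)‖ := by
          have e : X r (φ r s (g s + v)) - X r (g r) - A r (J r v) =
            (X r (φ r s (g s + v)) - X r (g r) - A r (φ r s (g s + v) - g r)) +
              A r (φ r s (g s + v) - g r - J r v) := by
            rw [map_sub (A r) _ (J r v)]; abel
          rw [e]; exact norm_add_le _ _
        have h5 : 2 * ε * C * ‖v‖ * (Real.exp ((M + 1) * |r - s|) * (M + 1)) =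
            (M + 1) * ‖φ r s (g s + v) - g r - J r v‖ := by rw [heq]; ring
        have h6 : 2 * ε * C * ‖v‖ ≤ ‖φ r s (g s + v) - g r - J r v‖ := by
          rw [heq]
          refine le_mul_of_one_le_right (by positivity) (Real.one_le_exp (by positivity))
        have h7 : ε * ‖φ r s (g s + v) - g r‖ ≤ ε * (C * ‖v‖) := by gcongr
        have h8 : 0 < ε * C * ‖v‖ := by positivity
        rw [h5]
        linarith)
    rw [hgt]
    refine this.trans (le_of_eq ?_)
    rw [← hKdef, hεdef]
    field_simp
  · have hder : ∀ r ∈ uIcc s t, HasDerivWithinAt (fun r => ω (J r u) (J r v)) 0 (uIcc s t) r := by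
      intro r hr
      have h1 : HasDerivWithinAt (fun r => ω (J r u)) (ω (A r (J r u))) (uIcc s t) r :=
        ω.hasFDerivAt.comp_hasDerivWithinAt r (hJu u r hr)
      have := h1.clm_apply (hJu v r hr)
      rwa [hω] at this
    have := (convex_uIcc s t).norm_image_sub_le_of_norm_hasDerivWithin_le
      (C := 0) hder (by simp) left_mem_uIcc right_mem_uIcc
    rw [zero_mul, norm_le_zero_iff, sub_eq_zero, hJs] at this
    simpa using this

/-- The flow maps are differentiable, and their derivatives preserve every bilinear form that the
linearised vector field preserves. -/
theorem IsFlow.exists_hasFDerivAt [CompleteSpace E] (hφ : IsFlow X φ) (hX : IsC1VectorField X DX)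
    (hω : ∀ t x u v, ω (DX t x u) v + ω u (DX t x v) = 0) {s t : ℝ} (hs : 0 ≤ s) (ht : 0 ≤ t)
    (x : E) : ∃ D : E →L[ℝ] E, HasFDerivAt (φ t s) D x ∧ ∀ u v, ω (D u) (D v) = ω u v := by
  have hg := hφ.trajectory s hs x
  obtain ⟨δ, hδ, H⟩ := hφ.exists_hasFDerivAt_of_abs_sub_le hX hω hg (max s t)
  -- Since `δ` is uniform on `[0, max s t]`, `k` equal steps shorter than `δ` lead from `s` to `t`,
  -- and the chain rule composes their derivatives.
  obtain ⟨k, hk⟩ := exists_nat_gt (|t - s| / δ)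
  have hk0 : (0 : ℝ) < k := lt_of_le_of_lt (by positivity) hk
  set p : ℕ → ℝ := fun i => s + (i / k : ℝ) * (t - s) with hp
  have hmem : ∀ i ≤ k, p i ∈ Icc 0 (max s t) := fun i hi => by
    have h0 : (0 : ℝ) ≤ i / k := by positivity
    have h1 : (i / k : ℝ) ≤ 1 := (div_le_one hk0).2 (by exact_mod_cast hi)
    have e : p i = (1 - i / k) * s + (i / k) * t := by rw [hp]; ring
    rw [e]
    refine ⟨add_nonneg (mul_nonneg (by linarith) hs) (mul_nonneg h0 ht), ?_⟩
    calc _ ≤ (1 - (i / k : ℝ)) * max s t + (i / k) * max s t := by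
          have h2 : (0 : ℝ) ≤ 1 - i / k := by linarith
          exact add_le_add (mul_le_mul_of_nonneg_left (le_max_left s t) h2)
            (mul_le_mul_of_nonneg_left (le_max_right s t) h0)
      _ = _ := by ring
  have hp0 : p 0 = s := by simp [hp]
  have hpk : p k = t := by simp [hp, div_self hk0.ne']
  have main : ∀ i ≤ k, ∃ D : E →L[ℝ] E, HasFDerivAt (φ (p i) s) D x ∧
      ∀ u v, ω (D u) (D v) = ω u v := by
    intro i
    induction i with
    | zero =>
      intro _
      rw [hp0]
      have : φ s s = id := funext fun y => hφ.self s hs y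
      rw [this]
      exact ⟨ContinuousLinearMap.id ℝ E, hasFDerivAt_id x, fun u v => rfl⟩
    | succ i ih =>
      intro hi
      obtain ⟨D, hD, hDω⟩ := ih (by omega)
      have hpi := hmem i (by omega)
      have hpi' := hmem (i + 1) hi
      obtain ⟨D', hD', hDω'⟩ := H (p i) hpi (p (i + 1)) hpi' (by
        have e : p (i + 1) - p i = (t - s) / k := by simp only [hp]; push_cast; ring
        rw [e, abs_div, abs_of_pos hk0, div_le_iff₀ hk0]
        rw [div_lt_iff₀ hδ] at hk
        linarith)
      have e : φ (p (i + 1)) s = φ (p (i + 1)) (p i) ∘ φ (p i) s := funext fun y =>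
        (hφ.comp_apply hX hs hpi.1 hpi'.1 y).symm
      refine ⟨D'.comp D, ?_, fun u v => ?_⟩
      · rw [e]; exact hD'.comp x hD
      · simp [hDω', hDω]
  simpa [hpk] using main k le_rfl

/-- Dependence of the flow on the initial time and position. -/
theorem IsFlow.hasFDerivWithinAt_initial (hφ : IsFlow X φ) (hX : IsC1VectorField X DX) {t : ℝ}
    (ht : 0 ≤ t) (x : E) : HasFDerivWithinAt (fun z : ℝ × E => φ t z.1 z.2)
      (ContinuousLinearMap.snd ℝ ℝ E - (ContinuousLinearMap.fst ℝ ℝ E).smulRight (X t x))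
      (Ici 0 ×ˢ univ) (t, x) := by
  rw [hasFDerivWithinAt_iff_isLittleO, Asymptotics.isLittleO_iff]
  intro ε hε
  obtain ⟨δ, hδ, hcont⟩ := Metric.continuousAt_iff.1 (hX.continuous.continuousAt (x := (t, x))) ε hε
  -- The three terms account for `y - x`, for the remainder on the barrier and for the drift: at
  -- contact the trajectory is within `K * m` of `x`, hence in the continuity ball.
  set K := 1 + (ε + ‖X t x‖) with hK
  have hKpos : 0 < K := by positivity
  rw [eventually_nhdsWithin_iff]
  filter_upwards [Metric.ball_mem_nhds (t, x) (div_pos hδ hKpos)] with z hz hz0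
  obtain ⟨s, y⟩ := z
  have hs : 0 ≤ s := hz0.1
  rw [Metric.mem_ball, lt_div_iff₀ hKpos, Prod.dist_eq, Real.dist_eq, dist_eq_norm] at hz
  simp only at hz
  set m := max |s - t| ‖y - x‖ with hm
  have h1 : |s - t| ≤ m := le_max_left _ _
  have h2 : ‖y - x‖ ≤ m := le_max_right _ _
  have hm0 : 0 ≤ m := (abs_nonneg _).trans h1
  have htr := hφ.trajectory s hs y
  have hB : ∀ u, HasDerivAt (fun u => ε * u) ε u := fun u => by
    simpa using (hasDerivAt_id u).const_mul ε
  have := norm_le_barrier_of_norm_deriv_lt (f := fun r => φ r s y - y - (r - s) • X t x)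
      (f' := fun r => X r (φ r s y) - X t x) (a := s) (b := t)
      (fun r hr => by
        have e1 := (htr.hasDerivWithinAt_uIcc hs ht hr).sub_const y
        have e2 := (((hasDerivAt_id r).sub_const s).smul_const (X t x)).hasDerivWithinAt
          (s := uIcc s t)
        simpa using! e1.sub e2) hB (by simp [hφ.self s hs])
      (fun r hr heq => by
        have hrs : |r - s| ≤ m := by
          have := abs_sub_left_of_mem_uIcc hr
          rw [abs_sub_comm t s] at this
          exact this.trans h1
        have hrt : |r - t| ≤ m := by
          have := abs_sub_right_of_mem_uIcc hr
          rw [abs_sub_comm t r, abs_sub_comm t s] at this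
          exact this.trans h1
        have hle : ‖φ r s y - x‖ ≤ K * m := by
          have e : φ r s y - x = (φ r s y - y - (r - s) • X t x) + (r - s) • X t x + (y - x) := by
            abel
          rw [e]
          refine (norm_add₃_le).trans ?_
          rw [heq, norm_smul, Real.norm_eq_abs]
          have : |r - s| * ‖X t x‖ ≤ m * ‖X t x‖ := by gcongr
          have : ε * |r - s| ≤ ε * m := by gcongr
          rw [hK]; linarith
        have hmK : m ≤ K * m := le_mul_of_one_le_left hm0 (by rw [hK]; linarith [norm_nonneg (X t x)])
        have := hcont (x := (r, φ r s y)) (by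
          rw [Prod.dist_eq, Real.dist_eq, dist_eq_norm]
          exact max_lt (by simp only; linarith) (by simp only; linarith))
        rwa [dist_eq_norm] at this)
  have e : φ t (s, y).1 (s, y).2 - φ t (t, x).1 (t, x).2 -
      (ContinuousLinearMap.snd ℝ ℝ E - (ContinuousLinearMap.fst ℝ ℝ E).smulRight (X t x))
        ((s, y) - (t, x)) = φ t s y - y - (t - s) • X t x := by
    simp only [hφ.self t ht, sub_apply, Prod.mk_sub_mk,
      ContinuousLinearMap.coe_snd', ContinuousLinearMap.smulRight_apply,
      ContinuousLinearMap.coe_fst']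
    rw [sub_smul, sub_smul]; abel
  rw [e]
  refine this.trans ?_
  rw [abs_sub_comm t s]
  have : ‖((s, y) : ℝ × E) - (t, x)‖ = m := by simp [Prod.norm_def, hm]
  rw [this]
  gcongr

/-- Joint differentiability of the flow in the initial time and position. -/
theorem IsFlow.exists_hasFDerivWithinAt_initial [CompleteSpace E] (hφ : IsFlow X φ)
    (hX : IsC1VectorField X DX)
    (hω : ∀ t x u v, ω (DX t x u) v + ω u (DX t x v) = 0) {s t : ℝ} (hs : 0 ≤ s) (ht : 0 ≤ t)
    (x : E) : ∃ D : E →L[ℝ] E, HasFDerivAt (φ t s) D x ∧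
      HasFDerivWithinAt (fun z : ℝ × E => φ t z.1 z.2)
        (D.comp (ContinuousLinearMap.snd ℝ ℝ E -
          (ContinuousLinearMap.fst ℝ ℝ E).smulRight (X s x))) (Ici 0 ×ˢ univ) (s, x) := by
  obtain ⟨D, hD, -⟩ := hφ.exists_hasFDerivAt hX hω hs ht x
  refine ⟨D, hD, ?_⟩
  have h1 := hφ.hasFDerivWithinAt_initial hX hs x
  have h2 : HasFDerivAt (φ t s) D ((fun z : ℝ × E => φ s z.1 z.2) (s, x)) := by
    simpa [hφ.self s hs] using hD
  -- Factoring the flow through time `s` reduces joint differentiability to the case of coinciding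
  -- times and to the spatial derivative.
  refine (h2.comp_hasFDerivWithinAt (s, x) h1).congr (fun z hz => ?_) ?_
  · exact (hφ.comp_apply hX hz.1 hs ht z.2).symm
  · exact (hφ.comp_apply hX hs hs ht x).symm

end FlowDeriv

/-! ### Volume preservation and the `L¹` displacement of observables. -/

section FlowMeasure

variable {E : Type*} [NormedAddCommGroup E] [NormedSpace ℝ E] [FiniteDimensional ℝ E]
  {X : ℝ → E → E} {DX : ℝ → E → E →L[ℝ] E} {φ : ℝ → ℝ → E → E} {ω : E →L[ℝ] E →L[ℝ] ℝ}

/-- In a basis, invariance reads `Dᵀ B D = B` with `det B ≠ 0`, so `(det D)² = 1`. The sign is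
irrelevant for the change of variables. -/
theorem abs_det_eq_one_of_preserves_form (hsep : ∀ u, (∀ v, ω u v = 0) → u = 0) {D : E →L[ℝ] E}
    (hD : ∀ u v, ω (D u) (D v) = ω u v) : |D.det| = 1 := by
  let b := Module.finBasis ℝ E
  let B : LinearMap.BilinForm ℝ E := LinearMap.mk₂ ℝ (fun u v => ω u v) (by simp) (by simp)
    (by simp) (by simp)
  have hB : B.SeparatingLeft := fun u hu => hsep u hu
  rw [← LinearMap.separatingLeft_toMatrix₂_iff b b, Matrix.separatingLeft_iff_det_ne_zero] at hB
  have hcomp : B.comp D.toLinearMap D.toLinearMap = B := LinearMap.ext₂ fun u v => hD u v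
  have h := congrArg Matrix.det (LinearMap.BilinForm.toMatrix_comp b b B D D)
  rw [hcomp, Matrix.det_mul, Matrix.det_mul, Matrix.det_transpose, LinearMap.det_toMatrix] at h
  have h2 : D.det * D.det = 1 := by
    refine mul_right_cancel₀ (b := (LinearMap.BilinForm.toMatrix b B).det) hB ?_
    rw [one_mul]
    conv_rhs => rw [h]
    change D.toLinearMap.det * D.toLinearMap.det * _ = _
    ring
  rcases mul_self_eq_one_iff.1 h2 with h3 | h3 <;> rw [h3] <;> simp

variable [MeasurableSpace E] [BorelSpace E] {μ : Measure E}

/-- **Liouville's theorem**: a flow whose linearised vector field preserves a nondegenerate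
bilinear form preserves the Haar measure. -/
theorem IsFlow.measurePreserving [μ.IsAddHaarMeasure] (hφ : IsFlow X φ)
    (hX : IsC1VectorField X DX) (hω : ∀ t x u v, ω (DX t x u) v + ω u (DX t x v) = 0)
    (hsep : ∀ u, (∀ v, ω u v = 0) → u = 0) {s t : ℝ} (hs : 0 ≤ s) (ht : 0 ≤ t) :
    MeasurePreserving (φ t s) μ μ := by
  have : CompleteSpace E := FiniteDimensional.complete ℝ E
  choose D hD hDω using hφ.exists_hasFDerivAt hX hω hs ht
  have hmeas : Measurable (φ t s) :=
    (continuous_iff_continuousAt.2 fun x => (hD x).continuousAt).measurable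
  have hinj : Function.Injective (φ t s) :=
    Function.LeftInverse.injective (g := φ s t) (hφ.inverse_apply hX hs ht)
  have hsurj : Function.Surjective (φ t s) :=
    Function.RightInverse.surjective (g := φ s t) (hφ.inverse_apply hX ht hs)
  refine ⟨hmeas, Measure.ext_of_lintegral _ fun f hf => ?_⟩
  rw [lintegral_map hf hmeas]
  have := lintegral_image_eq_lintegral_abs_det_fderiv_mul μ MeasurableSet.univ
    (fun x _ => (hD x).hasFDerivWithinAt) hinj.injOn f
  rw [image_univ, hsurj.range_eq] at this
  simpa [abs_det_eq_one_of_preserves_form hsep (hDω _)] using this.symm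

/-- The `L¹` distance that an observable moves along a measure preserving flow. -/
theorem IsFlow.lintegral_enorm_sub_le [SFinite μ] (hφ : IsFlow X φ) (hX : IsC1VectorField X DX)
    (hmp : ∀ s t, 0 ≤ s → 0 ≤ t → MeasurePreserving (φ t s) μ μ)
    (hcont : ∀ s t, 0 ≤ s → 0 ≤ t → Continuous (φ t s)) {F : E → ℝ} (hF : ContDiff ℝ 1 F)
    {s t : ℝ} (hs : 0 ≤ s) (ht : 0 ≤ t) :
    ∫⁻ x, ‖F (φ t s x) - F x‖ₑ ∂μ ≤ ∫⁻ r in uIoc t s, ∫⁻ x, ‖fderiv ℝ F x (X r x)‖ₑ ∂μ := by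
  have hG : Continuous fun z : ℝ × E => fderiv ℝ F z.2 (X z.1 z.2) :=
    ((hF.continuous_fderiv one_ne_zero).comp continuous_snd).clm_apply hX.continuous
  have hsub : uIoc t s ⊆ Ici 0 := uIoc_subset_uIcc.trans (uIcc_subset_Ici ht hs)
  have hFm : Measurable F := hF.continuous.measurable
  have hpt : ∀ y, ‖F (φ s t y) - F y‖ₑ ≤
      ∫⁻ r in uIoc t s, ‖fderiv ℝ F (φ (max r 0) t y) (X r (φ (max r 0) t y))‖ₑ := by
    intro y
    have htr := hφ.trajectory t ht y
    have hc : Continuous fun r => fderiv ℝ F (φ (max r 0) t y) (X r (φ (max r 0) t y)) :=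
      hG.comp (continuous_id.prodMk htr.continuous_max)
    have hftc := intervalIntegral.integral_eq_sub_of_hasDeriv_right (f := fun r => F (φ r t y))
      (f' := fun r => fderiv ℝ F (φ (max r 0) t y) (X r (φ (max r 0) t y))) (a := t) (b := s)
      (fun r hr => ((htr.hasDerivWithinAt_comp hF (uIcc_subset_Ici ht hs hr)).mono
        (uIcc_subset_Ici ht hs)).continuousWithinAt)
      (fun r hr => by
        have h0 : 0 ≤ r := (le_min ht hs).trans hr.1.le
        have := htr.hasDerivWithinAt_comp hF h0
        simp only [max_eq_left h0]
        exact this.mono fun q hq => h0.trans (mem_Ioi.1 hq).le)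
      (hc.intervalIntegrable _ _)
    rw [hφ.self t ht] at hftc
    rw [← hftc, ← enorm_norm, intervalIntegral.norm_integral_eq_norm_integral_uIoc, enorm_norm]
    exact enorm_integral_le_lintegral_enorm _
  have hmeas : Measurable fun z : ℝ × E =>
      ‖fderiv ℝ F (φ (max z.1 0) t z.2) (X z.1 (φ (max z.1 0) t z.2))‖ₑ := by
    have h1 : Measurable (Function.uncurry fun (r : ℝ) (y : E) => φ (max r 0) t y) :=
      measurable_uncurry_of_continuous_of_measurable
        (fun y => (hφ.trajectory t ht y).continuous_max)
        (fun r => (hcont t (max r 0) ht (le_max_right _ _)).measurable)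
    exact (hG.measurable.comp (measurable_fst.prodMk h1)).enorm
  -- Substituting `x = φ s t y` trades the initial time for the final time, in which the flow solves
  -- the equation. After Tonelli, a second use of invariance removes the flow from the integrand.
  calc ∫⁻ x, ‖F (φ t s x) - F x‖ₑ ∂μ = ∫⁻ y, ‖F (φ s t y) - F y‖ₑ ∂μ := by
        refine ((hmp t s ht hs).lintegral_comp
          ((hFm.comp (hmp s t hs ht).measurable).sub hFm).enorm).symm.trans
          (lintegral_congr fun y => ?_)
        simp only [Function.comp_apply, Pi.sub_apply]
        rw [hφ.inverse_apply hX ht hs, ← enorm_neg, neg_sub]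
    _ ≤ ∫⁻ y, (∫⁻ r in uIoc t s,
          ‖fderiv ℝ F (φ (max r 0) t y) (X r (φ (max r 0) t y))‖ₑ) ∂μ := lintegral_mono hpt
    _ = ∫⁻ r in uIoc t s, ∫⁻ y,
          ‖fderiv ℝ F (φ (max r 0) t y) (X r (φ (max r 0) t y))‖ₑ ∂μ :=
        lintegral_lintegral_swap (f := fun y r =>
          ‖fderiv ℝ F (φ (max r 0) t y) (X r (φ (max r 0) t y))‖ₑ)
          (hmeas.comp measurable_swap).aemeasurable
    _ = ∫⁻ r in uIoc t s, ∫⁻ x, ‖fderiv ℝ F x (X r x)‖ₑ ∂μ := by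
        refine setLIntegral_congr_fun measurableSet_uIoc fun r hr => ?_
        simp only [max_eq_left (mem_Ici.1 (hsub hr))]
        exact (hmp t r ht (hsub hr)).lintegral_comp
          ((hG.comp (continuous_const.prodMk continuous_id)).measurable.enorm)

end FlowMeasure

/-! ### Symplectic algebra and the Gibbs state. -/

namespace PhaseSpace

variable {n : ℕ}

/-- The linear map taking a differential `dh` to the Hamiltonian vector `(∂h/∂p, -∂h/∂q)`. -/
def sharp (n : ℕ) : (PhaseSpace n →L[ℝ] ℝ) →L[ℝ] PhaseSpace n :=
  (ContinuousLinearMap.pi fun i => ContinuousLinearMap.apply ℝ ℝ (0, Pi.single i 1)).prod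
    (ContinuousLinearMap.pi fun i => -ContinuousLinearMap.apply ℝ ℝ (Pi.single i 1, 0))

/-- The symplectic form `∑ᵢ dqᵢ ∧ dpᵢ`. -/
def symplecticForm (n : ℕ) : PhaseSpace n →L[ℝ] PhaseSpace n →L[ℝ] ℝ :=
  let q (i : Fin n) : PhaseSpace n →L[ℝ] ℝ :=
    (ContinuousLinearMap.proj (R := ℝ) (φ := fun _ : Fin n => ℝ) i).comp
      (ContinuousLinearMap.fst ℝ _ _)
  let p (i : Fin n) : PhaseSpace n →L[ℝ] ℝ :=
    (ContinuousLinearMap.proj (R := ℝ) (φ := fun _ : Fin n => ℝ) i).comp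
      (ContinuousLinearMap.snd ℝ _ _)
  ∑ i, ((q i).smulRight (p i) - (p i).smulRight (q i))

theorem symplecticForm_apply (u v : PhaseSpace n) :
    symplecticForm n u v = ∑ i, (u.1 i * v.2 i - u.2 i * v.1 i) := by
  simp [symplecticForm]

theorem symplecticForm_neg_flip (u v : PhaseSpace n) :
    symplecticForm n u v = -symplecticForm n v u := by
  rw [symplecticForm_apply, symplecticForm_apply, ← Finset.sum_neg_distrib]
  exact Finset.sum_congr rfl fun i _ => by ring

theorem symplecticForm_separating (u : PhaseSpace n) (hu : ∀ v, symplecticForm n u v = 0) :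
    u = 0 := by
  refine Prod.ext (funext fun i => ?_) (funext fun i => ?_)
  · simpa [symplecticForm_apply, Pi.single_apply] using hu (0, Pi.single i 1)
  · simpa [symplecticForm_apply, Pi.single_apply] using hu (Pi.single i 1, 0)

/-- This duality turns the linearised Hamiltonian field into the Hessian and the Poisson bracket
into a directional derivative. -/
theorem symplecticForm_sharp (α : PhaseSpace n →L[ℝ] ℝ) (v : PhaseSpace n) :
    symplecticForm n (sharp n α) v = α v := by
  have hv : v = ∑ i, (v.1 i • ((Pi.single i 1, 0) : PhaseSpace n) +
      v.2 i • ((0, Pi.single i 1) : PhaseSpace n)) := by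
    refine Prod.ext (funext fun j => ?_) (funext fun j => ?_) <;>
      simp [Prod.fst_sum, Prod.snd_sum, Finset.sum_apply, Pi.single_apply]
  conv_rhs => rw [hv]
  rw [symplecticForm_apply, map_sum]
  refine Finset.sum_congr rfl fun i _ => ?_
  rw [map_add, map_smul, map_smul]
  simp [sharp]
  ring

theorem poisson_eq_neg_fderiv (f g : PhaseSpace n → ℝ) (x : PhaseSpace n) :
    poisson f g x = -fderiv ℝ g x (hamiltonVF f x) := by
  rw [← symplecticForm_sharp, symplecticForm_apply, poisson, ← Finset.sum_neg_distrib]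
  refine Finset.sum_congr rfl fun i _ => ?_
  simp [sharp, hamiltonVF, partialP, partialQ]
  ring

theorem isProbDensity_gibbs {β : ℝ} {h : PhaseSpace n → ℝ}
    (hZ : Integrable fun x => Real.exp (-β * h x)) : IsProbDensity (gibbs β h) := by
  have hpos : 0 < partitionFunction β h := integral_exp_pos hZ
  refine ⟨fun x => div_nonneg (Real.exp_nonneg _) hpos.le, hZ.div_const _, ?_⟩
  change ∫ x, Real.exp (-β * h x) / partitionFunction β h = 1
  rw [integral_div]
  exact div_self hpos.ne'

/-- The differential of the Gibbs state is a pointwise multiple of `dh`, and the bracket is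
antisymmetric. -/
theorem poisson_gibbs_self {β : ℝ} {h : PhaseSpace n → ℝ} (hh : Differentiable ℝ h)
    (x : PhaseSpace n) : poisson h (gibbs β h) x = 0 := by
  have hd : HasFDerivAt (gibbs β h) ((partitionFunction β h)⁻¹ •
      (Real.exp (-β * h x) • (-β) • fderiv ℝ h x)) x := by
    have := (((hh x).hasFDerivAt.const_mul (-β)).exp).mul_const (partitionFunction β h)⁻¹
    simpa only [gibbs, div_eq_mul_inv] using! this
  rw [poisson, Finset.sum_eq_zero]
  intro i _
  simp only [partialQ, partialP, hd.fderiv, smul_apply, smul_eq_mul]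
  ring

end PhaseSpace

/-! ### Hamiltonian flows, Liouville solutions and stationary mesostates. -/

section Hamiltonian

variable {n : ℕ} {L : Type*} {H : L → PhaseSpace n → ℝ} {lam : ℝ → L}
  {φ : ℝ → ℝ → PhaseSpace n → PhaseSpace n}

/-- The driven Hamiltonian vector field, with the protocol frozen at its initial value before
time `0`. -/
def drivenVF (H : L → PhaseSpace n → ℝ) (lam : ℝ → L) (t : ℝ) : PhaseSpace n → PhaseSpace n :=
  hamiltonVF (H (lam (max t 0)))

theorem IsHamiltonianFlow.isFlow (hφ : IsHamiltonianFlow H lam φ) :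
    IsFlow (drivenVF H lam) φ where
  self := hφ.self
  trajectory s hs x t ht := by
    have := hφ.hamilton s hs x t ht
    rwa [drivenVF, max_eq_left ht]

variable [TopologicalSpace L]

theorem IsRegularHamiltonian.isC1VectorField (hH : IsRegularHamiltonian H)
    (hlam : ContinuousOn lam (Ici 0)) : IsC1VectorField (drivenVF H lam)
      fun t x => (sharp n).comp (fderiv ℝ (fderiv ℝ (H (lam (max t 0)))) x) := by
  have hl : Continuous fun t => lam (max t 0) :=
    hlam.comp_continuous (by fun_prop) fun t => le_max_right t 0
  have hl2 : Continuous fun z : ℝ × PhaseSpace n => (lam (max z.1 0), z.2) :=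
    (hl.comp continuous_fst).prodMk continuous_snd
  exact
    { continuous := (sharp n).continuous.comp (hH.continuous_fderiv.comp hl2)
      continuous_deriv := continuous_const.clm_comp (hH.continuous_fderiv_fderiv.comp hl2)
      hasFDerivAt := fun t x => (sharp n).hasFDerivAt.comp x
        (((hH.contDiff _).fderiv_right (m := 1) (by norm_num)).differentiable
          one_ne_zero).differentiableAt.hasFDerivAt }

/-- By duality the two terms are the Hessian at `(u, v)` and minus the Hessian at `(v, u)`; they
cancel by symmetry of second derivatives. -/
theorem IsRegularHamiltonian.deriv_preserves_symplecticForm (hH : IsRegularHamiltonian H) (t : ℝ)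
    (x u v : PhaseSpace n) :
    symplecticForm n ((sharp n).comp (fderiv ℝ (fderiv ℝ (H (lam (max t 0)))) x) u) v +
      symplecticForm n u ((sharp n).comp (fderiv ℝ (fderiv ℝ (H (lam (max t 0)))) x) v) = 0 := by
  rw [symplecticForm_neg_flip u]
  simp only [ContinuousLinearMap.comp_apply, symplecticForm_sharp]
  rw [((hH.contDiff _).contDiffAt.isSymmSndFDerivAt (by simp)).eq, add_neg_cancel]

instance (n : ℕ) : (volume : Measure (PhaseSpace n)).IsAddHaarMeasure :=
  Measure.prod.instIsAddHaarMeasure (volume : Measure (Fin n → ℝ)) (volume : Measure (Fin n → ℝ))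

theorem IsHamiltonianFlow.measurePreserving (hφ : IsHamiltonianFlow H lam φ)
    (hH : IsRegularHamiltonian H) (hlam : ContinuousOn lam (Ici 0)) {s t : ℝ} (hs : 0 ≤ s)
    (ht : 0 ≤ t) : MeasurePreserving (φ t s) :=
  hφ.isFlow.measurePreserving (hH.isC1VectorField hlam) hH.deriv_preserves_symplecticForm
    symplecticForm_separating hs ht

theorem IsHamiltonianFlow.continuous (hφ : IsHamiltonianFlow H lam φ)
    (hH : IsRegularHamiltonian H) (hlam : ContinuousOn lam (Ici 0)) {s t : ℝ} (hs : 0 ≤ s)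
    (ht : 0 ≤ t) : Continuous (φ t s) :=
  continuous_iff_continuousAt.2 fun x =>
    (hφ.isFlow.exists_hasFDerivAt (hH.isC1VectorField hlam) hH.deriv_preserves_symplecticForm
      hs ht x).choose_spec.1.continuousAt

/-- Transporting a probability density backwards along the flow solves the Liouville equation. -/
theorem IsHamiltonianFlow.isLiouvilleSolution (hφ : IsHamiltonianFlow H lam φ)
    (hH : IsRegularHamiltonian H) (hlam : ContinuousOn lam (Ici 0)) {F : PhaseSpace n → ℝ}
    (hF : ContDiff ℝ 1 F) (hFd : IsProbDensity F) {t : ℝ} (ht : 0 ≤ t) :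
    IsLiouvilleSolution H lam fun s x => F (φ t s x) := by
  have hFm := hF.continuous.measurable
  have hFdiff : ∀ x, HasFDerivAt F (fderiv ℝ F x) x := fun x =>
    (hF.differentiable one_ne_zero).differentiableAt.hasFDerivAt
  have key := fun s hs x => hφ.isFlow.exists_hasFDerivWithinAt_initial (s := s) (t := t)
    (hH.isC1VectorField hlam) hH.deriv_preserves_symplecticForm hs ht x
  refine ⟨?_, fun s hs => ?_, fun s hs x => ?_⟩
  · rintro ⟨s, x⟩ hz
    obtain ⟨D, -, hD⟩ := key s hz.1 x
    exact ((hFdiff (φ t s x)).comp_hasFDerivWithinAt (s, x) hD).differentiableWithinAt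
  · have hmp := hφ.measurePreserving hH hlam hs ht
    refine ⟨fun x => hFd.nonneg _, hmp.integrable_comp_of_integrable hFd.integrable, ?_⟩
    have := integral_map hmp.measurable.aemeasurable (f := F)
      (μ := (volume : Measure (PhaseSpace n))) hFm.aestronglyMeasurable
    rw [← this, hmp.map_eq, hFd.integral_eq_one]
  · obtain ⟨D, hD, hD2⟩ := key s hs x
    have h1 : HasFDerivAt (fun y => F (φ t s y)) ((fderiv ℝ F (φ t s x)).comp D) x :=
      (hFdiff (φ t s x)).comp x hD
    have h2 := (hFdiff (φ t s x)).comp_hasFDerivWithinAt (s, x) hD2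
    have h3 : HasDerivWithinAt (fun r : ℝ => (r, x)) ((1 : ℝ), (0 : PhaseSpace n)) (Ici 0) s :=
      ((hasDerivAt_id s).prodMk (hasDerivAt_const s x)).hasDerivWithinAt
    have h4 := h2.comp_hasDerivWithinAt s h3 (t := Ici 0 ×ˢ univ) (fun r hr => ⟨hr, mem_univ x⟩)
    -- Both sides are `-dF (D X)`: moving the initial time forward displaces the initial point by
    -- `-X`.
    rw [poisson_eq_neg_fderiv, h1.fderiv]
    simpa [Function.comp_def, drivenVF, max_eq_left hs] using h4

theorem contDiff_gibbs (hH : IsRegularHamiltonian H) (β : ℝ) (l : L) :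
    ContDiff ℝ 1 (gibbs β (H l)) :=
  ((contDiff_const.mul ((hH.contDiff l).of_le (by norm_num))).exp).div_const _

/-- If the Poisson bracket with the density `F` vanishes at time `t`, and is `L¹`-continuous
there, then the mesostate of the transported density is stationary at `t`. -/
theorem IsHamiltonianFlow.hasMesoDerivAt_zero {A : Type*} [MeasurableSpace A]
    (hφ : IsHamiltonianFlow H lam φ) (hH : IsRegularHamiltonian H)
    (hlam : ContinuousOn lam (Ici 0)) {χ : PhaseSpace n → A} (hχ : Measurable χ)
    {F : PhaseSpace n → ℝ} (hF : ContDiff ℝ 1 F) (hFi : Integrable F) {t : ℝ} (ht : 0 ≤ t)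
    (hlim : Tendsto (fun r => ∫⁻ x, ‖poisson (H (lam r)) F x‖ₑ) (𝓝[Ici 0] t) (𝓝 0)) :
    HasMesoDerivAt (fun s => mesoState χ fun x => F (φ t s x)) 0 t := by
  intro B hB
  have hint : ∀ s, 0 ≤ s → Integrable fun x => F (φ t s x) := fun s hs =>
    (hφ.measurePreserving hH hlam hs ht).integrable_comp_of_integrable hFi
  have hself : (fun x => F (φ t t x)) = F := funext fun x => by rw [hφ.self t ht]
  rw [hasDerivWithinAt_iff_isLittleO, Asymptotics.isLittleO_iff]
  intro ε hε
  have hev := hlim.eventually_lt_const (u := ENNReal.ofReal ε) (by simpa using hε)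
  obtain ⟨δ, hδ, hball⟩ := Metric.mem_nhdsWithin_iff.1 hev
  filter_upwards [self_mem_nhdsWithin, mem_nhdsWithin_of_mem_nhds (Metric.ball_mem_nhds t hδ)]
    with s hs hsδ
  have hs : 0 ≤ s := hs
  have hbound : ∫⁻ x, ‖F (φ t s x) - F x‖ₑ ≤ ENNReal.ofReal (ε * |s - t|) := by
    refine (hφ.isFlow.lintegral_enorm_sub_le (hH.isC1VectorField hlam)
      (fun _ _ => hφ.measurePreserving hH hlam) (fun _ _ => hφ.continuous hH hlam)
      hF hs ht).trans ?_
    -- All intermediate times `r` are as close to `t` as `s` is, so the bracket has `L¹` norm below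
    -- `ε` throughout.
    calc _ ≤ ∫⁻ r in uIoc t s, ENNReal.ofReal ε := by
          refine setLIntegral_mono' measurableSet_uIoc fun r hr => ?_
          have hr' : r ∈ uIcc t s := uIoc_subset_uIcc hr
          have hr0 : 0 ≤ r := uIcc_subset_Ici ht hs hr'
          have hrb : r ∈ Metric.ball t δ := by
            rw [Metric.mem_ball, Real.dist_eq] at hsδ ⊢
            exact (abs_sub_left_of_mem_uIcc hr').trans_lt hsδ
          have hlt : ∫⁻ x, ‖poisson (H (lam r)) F x‖ₑ < ENNReal.ofReal ε := hball ⟨hrb, hr0⟩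
          simp only [poisson_eq_neg_fderiv, enorm_neg] at hlt
          simpa [drivenVF, max_eq_left hr0] using hlt.le
      _ = ENNReal.ofReal (ε * |s - t|) := by
          rw [setLIntegral_const, Real.volume_uIoc, ENNReal.ofReal_mul hε.le]
  have heq : mesoState χ (fun x => F (φ t s x)) B - mesoState χ (fun x => F (φ t t x)) B =
      ∫ x in χ ⁻¹' B, (F (φ t s x) - F x) := by
    rw [hself, mesoState_apply hχ (hint s hs) hB, mesoState_apply hχ hFi hB,
      integral_sub (hint s hs).integrableOn hFi.integrableOn]
  simp only [heq, FunLike.coe_zero, Pi.zero_apply, smul_zero, sub_zero]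
  have : ‖∫ x in χ ⁻¹' B, (F (φ t s x) - F x)‖ₑ ≤ ENNReal.ofReal (ε * |s - t|) :=
    (enorm_integral_le_lintegral_enorm _).trans ((setLIntegral_le_lintegral _ _).trans hbound)
  rw [← ofReal_norm, ENNReal.ofReal_le_ofReal_iff (by positivity)] at this
  simpa using this

end Hamiltonian

end

/-! ### The Gibbs marginal as a fixed point. -/

theorem mainTheorem11 {n : ℕ} {L A : Type*} [TopologicalSpace L] [MeasurableSpace A]
    (H : L → PhaseSpace n → ℝ) (hH : IsRegularHamiltonian H)
    (lam : ℝ → L) (hlam : ContinuousOn lam (Ici 0))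
    (φ : ℝ → ℝ → PhaseSpace n → PhaseSpace n) (hφ : IsHamiltonianFlow H lam φ)
    (χ : PhaseSpace n → A) (hχ : Measurable χ)
    (I : Set ℝ) (hI : I.OrdConnected) (hI0 : I ⊆ Ici 0)
    (β : ℝ) (hβ : 0 < β)
    -- the Gibbs state exists: the partition function is finite
    (hZ : ∀ t ∈ I, Integrable (fun x => Real.exp (-β * H (lam t) x)) volume)
    -- for each `t ∈ I`, the map `r ↦ {H(·; lam r), π(·; lam t)}` into `L¹` is continuous at `r = t`
    (hcont : ∀ t ∈ I, Tendsto
      (fun r => ∫⁻ x, ‖PhaseSpace.poisson (H (lam r)) (gibbs β (H (lam t))) x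
        - PhaseSpace.poisson (H (lam t)) (gibbs β (H (lam t))) x‖ₑ) (𝓝[Ici 0] t) (𝓝 0))
    (V : ℝ → (SignedMeasure A →ₗ.[ℝ] SignedMeasure A))
    (hV : IsLumpableOn H lam φ χ I V) :
    ∀ t ∈ I,
      (∀ B : Set A, MeasurableSet B → mesoState χ (gibbs β (H (lam t))) B
        = ∫ x in χ ⁻¹' B, Real.exp (-β * H (lam t) x) / partitionFunction β (H (lam t))) ∧
      IsInstantaneousFixedPoint (V t) (mesoState χ (gibbs β (H (lam t)))) := by
  intro t htI
  have ht : 0 ≤ t := hI0 htI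
  have hprob := PhaseSpace.isProbDensity_gibbs (hZ t htI)
  have hC1 := contDiff_gibbs hH β (lam t)
  refine ⟨fun B hB => mesoState_apply hχ hprob.integrable hB, ?_⟩
  have hlim := hcont t htI
  -- The subtracted bracket is zero, so `L¹` continuity says that the bracket itself tends to `0`.
  simp only [PhaseSpace.poisson_gibbs_self ((hH.contDiff (lam t)).differentiable two_ne_zero), sub_zero]
    at hlim
  have hfix := hV.generator _ (hφ.isLiouvilleSolution hH hlam hC1 hprob ht) t htI 0
    (hφ.hasMesoDerivAt_zero hH hlam hχ hC1 hprob.integrable ht hlim)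
  simpa only [hφ.self t ht] using! hfix
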